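/- There is an absolute constant $C>0$ such that the following holds for every integer $n\ge 1$, every real $\rho$ with $0\le\rho<1$ and every integer $b\ge 0$. Consider $n$ stations, with names $0,\dots,n-1$ and initially empty FIFO queues, attached to a multiple access channel without jamming and without collision detection: time is divided into rounds, and a message transmitted in a round is heard by all stations if and only if exactly one station transmits in that round. In each round the stations first transmit or pause and receive the feedback of the channel, and then new packets may be injected; a packet leaves its queue when it is heard. The adversary of type $(\rho,b)$ may inject packets into arbitrary stations, subject only to the restriction that in every contiguous segment of $t>0$ rounds at most $\rho t+b$ packets are injected in total. The stations execute the algorithm Move-Big-To-Front (MBTF). Each station keeps a private list of all stations, initially in increasing order of names, and a token is initially assigned to the first station on the list. In each round only the station that holds the token may transmit: it transmits the first packet of its queue, if it has one, together with a control bit that tells whether the station is big, that is, has at least $n$ packets in its queue; if its queue is empty, then it pauses (or, in the second version of the algorithm, transmits a message with a control bit only). If the station with the token is big, it is moved to the front of the list and keeps the token for the next round; otherwise the token passes to the next station on the list, in cyclic order. Then, for both versions of MBTF, every packet injected by any adversary of type $(\rho,b)$ is eventually heard on the channel, and the number of rounds from the round of its injection through the round in which it is heard is at most $C\,\dfrac{n(n+b)}{1-\rho}$.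 That is, the packet latency of MBTF against the adversary of type $(\rho,b)$ is $\mathcal{O}\bigl(\frac{n(n+b)}{1-\rho}\bigr)$. -/

import Mathlib

/-! Deterministic distributed broadcasting on a multiple access channel without jamming and without
collision detection, the leaky-bucket injection adversary, packet latency, and the algorithm
Move-Big-To-Front. -/

namespace MAC

/-- A packet is identified by the round and the station of its injection and by its index among the
packets injected into that station in that round. -/
structure Packet (n : ℕ) where
  round : ℕ
  station : Fin n
  index : ℕ

/-- A message carries control bits and possibly one packet. -/
structure Message (n : ℕ) (Bits : Type) where
  packet : Option (Packet n)
  bits : Bits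

/-- What a station may do in a round: pause, send a message made of control bits only, or send the
packet at the head of its queue together with control bits. -/
inductive Action (Bits : Type) where
  | pause : Action Bits
  | sendControl (bits : Bits) : Action Bits
  | sendPacket (bits : Bits) : Action Bits

/-- A deterministic distributed broadcast algorithm for `n` stations.  Every station has private
control variables of type `Var`.  Its action in a round depends on its name, its variables and the
number of packets in its queue; its next variables depend moreover on the feedback from the channel
(the message heard, or `none` when nothing is heard) and on the number of packets injected into it
in this round. -/
structure Algorithm (n : ℕ) where
  Var : Type
  Bits : Type
  init : Fin n → Var
  act : Fin n → Var → ℕ → Action Bits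
  update : Fin n → Var → ℕ → Option (Message n Bits) → ℕ → Var

/-- The state of a station: its private variables and its queue, the head being the oldest packet. -/
structure StationState {n : ℕ} (A : Algorithm n) where
  vars : A.Var
  queue : List (Packet n)

/-- The message (if any) that station `i` transmits when it is in state `s`. -/
def Algorithm.transmission {n : ℕ} (A : Algorithm n) (i : Fin n) (s : StationState A) :
    Option (Message n A.Bits) :=
  match A.act i s.vars s.queue.length with
  | Action.pause => none
  | Action.sendControl c => some ⟨none, c⟩
  | Action.sendPacket c => some ⟨s.queue.head?, c⟩

/-- The feedback of a channel without jamming and without collision detection: a message is heard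
exactly when exactly one station transmits; silence and collision are both perceived as `none`. -/
def channelFeedback {n : ℕ} {Bits : Type} (tx : Fin n → Option (Message n Bits)) :
    Option (Message n Bits) :=
  match (List.finRange n).filterMap tx with
  | [m] => some m
  | _ => none

/-- An injection pattern: `inj t i` packets are injected into station `i` in round `t`. -/
abbrev Injection (n : ℕ) : Type := ℕ → Fin n → ℕ

/-- The packets injected into station `i` in round `t`, when there are `k` of them. -/
def newPackets {n : ℕ} (t : ℕ) (i : Fin n) (k : ℕ) : List (Packet n) :=
  (List.range k).map fun j => ⟨t, i, j⟩

/-- The feedback that all stations receive in a round that begins in the configuration `c`. -/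
def Algorithm.feedback {n : ℕ} (A : Algorithm n) (c : Fin n → StationState A) :
    Option (Message n A.Bits) :=
  channelFeedback fun i => A.transmission i (c i)

/-- The queue of a station in state `s` after its own transmission `tx` and the feedback `fb`: if the
station has transmitted, a message has been heard (it is then the only transmitter) and that message
contains a packet, then this packet, the head of the queue, is discarded. -/
def queueAfterFeedback {n : ℕ} {Bits : Type} (q : List (Packet n))
    (tx fb : Option (Message n Bits)) : List (Packet n) :=
  match tx, fb with
  | some _, some m => if m.packet.isSome then q.tail else q
  | _, _ => q

/-- One round: transmissions, feedback, injections, state transitions, in this order. -/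
def Algorithm.step {n : ℕ} (A : Algorithm n) (inj : Injection n) (t : ℕ)
    (c : Fin n → StationState A) : Fin n → StationState A := fun i =>
  { vars := A.update i (c i).vars (c i).queue.length (A.feedback c) (inj t i)
    queue := queueAfterFeedback (c i).queue (A.transmission i (c i)) (A.feedback c)
      ++ newPackets t i (inj t i) }

/-- The configuration at the beginning of round `t` (rounds are numbered `0, 1, 2, …`); all stations
start simultaneously with empty queues. -/
def Algorithm.config {n : ℕ} (A : Algorithm n) (inj : Injection n) : ℕ → Fin n → StationState A
  | 0 => fun i => ⟨A.init i, []⟩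
  | t + 1 => A.step inj t (A.config inj t)

/-- Packet `p` is heard on the channel in round `t`. -/
def Algorithm.HeardIn {n : ℕ} (A : Algorithm n) (inj : Injection n) (t : ℕ) (p : Packet n) : Prop :=
  ∃ m : Message n A.Bits, A.feedback (A.config inj t) = some m ∧ m.packet = some p

/-- The injection pattern is allowed to the leaky-bucket adversary of type `(ρ, b)`: at most
`ρ * len + b` packets are injected in every contiguous segment of `len > 0` rounds. -/
def LeakyBucket {n : ℕ} (ρ : ℝ) (b : ℕ) (inj : Injection n) : Prop :=
  ∀ s len : ℕ, 0 < len →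
    ((∑ t ∈ Finset.Ico s (s + len), ∑ i : Fin n, inj t i : ℕ) : ℝ) ≤ ρ * len + b

/-- `L` is an upper bound on the packet latency of `A` against the adversary of type `(ρ, b)`: every
injected packet is eventually heard, and the number of rounds from the round `t` of its injection
through the round `t'` in which it is heard, both included, is at most `L`. -/
def Algorithm.PacketLatencyAtMost {n : ℕ} (A : Algorithm n) (ρ : ℝ) (b : ℕ) (L : ℝ) : Prop :=
  ∀ inj : Injection n, LeakyBucket ρ b inj →
    ∀ (t : ℕ) (i : Fin n) (k : ℕ), k < inj t i →
      ∃ t' : ℕ, t < t' ∧ A.HeardIn inj t' ⟨t, i, k⟩ ∧ (t' : ℝ) - t + 1 ≤ L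

/-! ### Move-Big-To-Front -/

/-- The private variables of a station: a list of all stations, and the position on this list
(counted from `0`) of the station that holds the token. -/
structure MBTFVar (n : ℕ) where
  order : List (Fin n)
  token : ℕ

/-- The station that holds the token. -/
def MBTFVar.holder {n : ℕ} (v : MBTFVar n) : Option (Fin n) := v.order[v.token]?

/-- The holder of the token is moved to the front of the list and keeps the token. -/
def MBTFVar.moveToFront {n : ℕ} (v : MBTFVar n) : MBTFVar n :=
  match v.holder with
  | some h => ⟨h :: v.order.erase h, 0⟩
  | none => v

/-- The token is passed to the next station on the list, in a cyclic fashion. -/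
def MBTFVar.passToken {n : ℕ} (v : MBTFVar n) : MBTFVar n :=
  ⟨v.order, (v.token + 1) % n⟩

/-- Algorithm Move-Big-To-Front.  The control bit of a message tells whether its sender is big, that
is, has at least `n` packets in its queue.  A token holder without packets pauses if
`controlRounds = false`, and transmits a message with a control bit only if `controlRounds = true`;
these are the two versions of the algorithm. -/
def MBTF (n : ℕ) (controlRounds : Bool) : Algorithm n where
  Var := MBTFVar n
  Bits := Bool
  init := fun _ => ⟨List.finRange n, 0⟩
  act := fun i v q =>
    if v.holder = some i then
      if 0 < q then Action.sendPacket (decide (n ≤ q))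
      else if controlRounds then Action.sendControl false
      else Action.pause
    else Action.pause
  update := fun _ v _ fb _ =>
    match fb with
    | some m => if m.bits then v.moveToFront else v.passToken
    | none => v.passToken

end MAC

namespace MAC

open Finset

/-! Only the token holder transmits and all stations react to the same feedback, so their private
lists stay equal and the execution is a single token walk, packaged as `TokenTrace`. Each station
has potential max(slack, queue length). In every round the total potential drops by at least 1,
apart from injections and an increase of at most n when a pass through the list is completed
(`sum_potential_succ_le`). It never exceeds 2(n² + b) (`sum_potential_le`), and at most n passes are
completed while a packet waits (`waiting_invariant`). A wait of T rounds thus has T ≤ 3n² + 2b +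
injections (`waiting_time_le`). These bounds need only injection rate 1; rate ρ < 1 enters at the
end, where injections ≤ ρT + b is solved for T. -/

/-- A centralized description of an execution in which a token travels along a list of stations: the
position of every station on the list, the position and the holder of the token, and the queues. -/
structure TokenTrace (n : ℕ) (inj : Injection n) where
  pos : ℕ → Fin n → ℕ
  tok : ℕ → ℕ
  holder : ℕ → Fin n
  queue : ℕ → Fin n → List (Packet n)
  pos_lt : ∀ t j, pos t j < n
  pos_eq_iff : ∀ t j, pos t j = tok t ↔ j = holder t
  tok_zero : tok 0 = 0
  queue_zero : ∀ j, queue 0 j = []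
  queue_succ : ∀ t j, queue (t + 1) j =
    (if j = holder t then (queue t j).tail else queue t j) ++ newPackets t j (inj t j)
  tok_succ_of_big : ∀ t, n ≤ (queue t (holder t)).length → tok (t + 1) = 0
  pos_succ_of_big : ∀ t j, n ≤ (queue t (holder t)).length → pos (t + 1) j =
    if j = holder t then 0 else if pos t j < tok t then pos t j + 1 else pos t j
  tok_succ_of_small : ∀ t, (queue t (holder t)).length < n → tok (t + 1) = (tok t + 1) % n
  pos_succ_of_small : ∀ t j, (queue t (holder t)).length < n → pos (t + 1) j = pos t j

/-! ### Potential and passes in the token process -/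

namespace TokenTrace

variable {n : ℕ} {inj : Injection n} (R : TokenTrace n inj)

/-- The number of packets in the queue of a station. -/
def len (t : ℕ) (j : Fin n) : ℕ := (R.queue t j).length

/-- In round `t` the token leaves the last station on the list, which is not big. -/
def Completes (t : ℕ) : Prop := R.len t (R.holder t) < n ∧ R.tok t + 1 = n

open Classical in
/-- The indicator of the completion of a pass of the token through the whole list. -/
noncomputable def comp (t : ℕ) : ℕ := if R.Completes t then 1 else 0

/-- The number of visits that the token can still pay to `j` before `j` is last on the list. -/
def slack (t : ℕ) (j : Fin n) : ℕ := n - 1 - R.pos t j - if R.pos t j < R.tok t then 1 else 0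

/-- The potential of a station. -/
def potential (t : ℕ) (j : Fin n) : ℕ := max (R.slack t j) (R.len t j)

theorem len_succ (t : ℕ) (j : Fin n) :
    R.len (t + 1) j = (R.len t j - if j = R.holder t then 1 else 0) + inj t j := by
  simp only [len, R.queue_succ]
  split_ifs <;> simp [newPackets]

theorem tok_lt (t : ℕ) : R.tok t < n := by
  rw [← (R.pos_eq_iff t (R.holder t)).2 rfl]; exact R.pos_lt _ _

/-- A round is a move of a big station to the front, a completion of a pass, or a plain advance of
the token. -/
theorem round_cases (t : ℕ) :
    (n ≤ R.len t (R.holder t) ∧ R.comp t = 0 ∧ R.tok (t + 1) = 0 ∧ ∀ j, R.pos (t + 1) j =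
      if j = R.holder t then 0 else if R.pos t j < R.tok t then R.pos t j + 1 else R.pos t j) ∨
    (R.len t (R.holder t) < n ∧ R.comp t = 1 ∧ R.tok t + 1 = n ∧ R.tok (t + 1) = 0 ∧
      ∀ j, R.pos (t + 1) j = R.pos t j) ∨
    (R.len t (R.holder t) < n ∧ R.comp t = 0 ∧ R.tok t + 1 < n ∧ R.tok (t + 1) = R.tok t + 1 ∧
      ∀ j, R.pos (t + 1) j = R.pos t j) := by
  rcases le_or_gt n (R.len t (R.holder t)) with h | h
  · exact Or.inl ⟨h, if_neg fun hc => absurd hc.1 (by omega), R.tok_succ_of_big t h,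
      fun j => R.pos_succ_of_big t j h⟩
  · have ht := R.tok_succ_of_small t h
    have hp := fun j => R.pos_succ_of_small t j h
    rcases Nat.lt_or_ge (R.tok t + 1) n with h2 | h2
    · rw [Nat.mod_eq_of_lt h2] at ht
      exact Or.inr (Or.inr ⟨h, if_neg fun hc => absurd hc.2 (by omega), h2, ht, hp⟩)
    · have h3 : R.tok t + 1 = n := by have := R.tok_lt t; omega
      rw [h3, Nat.mod_self] at ht
      exact Or.inr (Or.inl ⟨h, if_pos ⟨h, h3⟩, h3, ht, hp⟩)

/-- A big holder loses a packet, and its slack at the front, n - 1, stays within its remaining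
queue. A small holder that is not last loses one unit of slack and a packet if it has one; its
positive slack makes the maximum drop even when the queue is empty. A station shifted back by a move
to the front had already been visited, so its slack is unchanged. Only a completed pass raises
slack, by one. -/
theorem potential_succ_le (t : ℕ) (j : Fin n) :
    R.potential (t + 1) j + (if j = R.holder t then 1 else 0) ≤
      R.potential t j + inj t j + R.comp t := by
  have hp := R.pos_lt t j
  have he := R.pos_eq_iff t j
  have hl := R.len_succ t j
  have ht := R.tok_lt t
  unfold potential slack
  rw [hl]
  rcases R.round_cases t with ⟨hb, hc, hk, hq⟩ | ⟨hb, hc, hm, hk, hq⟩ | ⟨hb, hc, hm, hk, hq⟩ <;>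
  · rw [hc, hk, hq j]
    by_cases hj : j = R.holder t
    · rw [← hj] at hb
      have := he.2 hj
      simp only [hj, if_true] at *
      split_ifs <;> omega
    · have := mt he.1 hj
      simp only [hj, if_false]
      split_ifs <;> omega

theorem potential_le (t : ℕ) (j : Fin n) : R.potential t j ≤ R.len t j + n := by
  unfold potential slack; omega

theorem sum_potential_succ_le (t : ℕ) :
    ∑ j, R.potential (t + 1) j + 1 ≤ ∑ j, R.potential t j + ∑ j, inj t j + n * R.comp t := by
  have := Finset.sum_le_sum fun j (_ : j ∈ univ) => R.potential_succ_le t j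
  simpa [Finset.sum_add_distrib] using this

theorem sum_potential_add_le (s T : ℕ) :
    ∑ j, R.potential (s + T) j + T ≤ ∑ j, R.potential s j +
      ∑ t ∈ Ico s (s + T), ∑ j, inj t j + n * ∑ t ∈ Ico s (s + T), R.comp t := by
  induction T with
  | zero => simp
  | succ T ih =>
    have := R.sum_potential_succ_le (s + T)
    simp only [← add_assoc s T 1]
    rw [Finset.sum_Ico_succ_top (by omega), Finset.sum_Ico_succ_top (by omega), mul_add]
    omega

/-- The stations that the token has visited in the present pass were small. -/
theorem len_le_of_pos_lt_tok (t : ℕ) : R.tok t ≤ t ∧ ∀ j, R.pos t j < R.tok t →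
    R.len t j ≤ n - 1 + ∑ s ∈ Ico (t - R.tok t) t, inj s j := by
  induction t with
  | zero => simp [R.tok_zero]
  | succ t ih =>
    rcases R.round_cases t with ⟨hb, hc, hk, hq⟩ | ⟨hb, hc, hm, hk, hq⟩ | ⟨hb, hc, hm, hk, hq⟩
    · simp [hk]
    · simp [hk]
    · refine ⟨by omega, fun j hj => ?_⟩
      rw [hq, hk] at hj
      rw [hk, Nat.add_sub_add_right, Finset.sum_Ico_succ_top (by omega), len_succ]
      by_cases h : j = R.holder t
      · rw [← h] at hb; omega
      · have := mt (R.pos_eq_iff t j).1 h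
        have := ih.2 j (by omega)
        omega

/-- A completed pass takes n consecutive rounds and finds every station small. Each queue is at most
n - 1 plus the injections during the pass, and these total at most n + b. -/
theorem sum_len_le_of_completes {b : ℕ}
    (hb : ∀ s T, ∑ t ∈ Ico s (s + T), ∑ j, inj t j ≤ T + b) {t : ℕ} (h : R.comp t = 1) :
    ∑ j, R.len (t + 1) j ≤ n * n + b := by
  rcases R.round_cases t with ⟨_, hc, _⟩ | ⟨hs, _, hm, _⟩ | ⟨_, hc, _⟩
  · omega
  · obtain ⟨ht, hl⟩ := R.len_le_of_pos_lt_tok t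
    have key : ∀ j, R.len (t + 1) j ≤ n - 1 + ∑ s ∈ Ico (t - R.tok t) (t + 1), inj s j := by
      intro j
      rw [Finset.sum_Ico_succ_top (by omega), len_succ]
      by_cases hj : j = R.holder t
      · rw [← hj] at hs; omega
      · have := mt (R.pos_eq_iff t j).1 hj
        have := R.pos_lt t j
        have := hl j (by omega)
        omega
    have h1 := Finset.sum_le_sum fun j (_ : j ∈ univ) => key j
    rw [Finset.sum_add_distrib, Finset.sum_comm] at h1
    have h2 := hb (t - R.tok t) n
    rw [show t - R.tok t + n = t + 1 by omega] at h2
    have h3 : n * (n - 1) + n = n * n := by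
      rw [← Nat.mul_succ, Nat.succ_eq_add_one, show n - 1 + 1 = n by omega]
    simp only [sum_const, card_univ, Fintype.card_fin, smul_eq_mul] at h1
    omega
  · omega

theorem sum_potential_le {b : ℕ}
    (hb : ∀ s T, ∑ t ∈ Ico s (s + T), ∑ j, inj t j ≤ T + b) (t : ℕ) :
    ∑ j, R.potential t j ≤ 2 * (n * n + b) := by
  have hS : ∀ t, ∑ j, R.potential t j ≤ ∑ j, R.len t j + n * n := fun t => by
    have := Finset.sum_le_sum fun j (_ : j ∈ univ) => R.potential_le t j
    simpa [Finset.sum_add_distrib] using this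
  -- Here `s` is the round after the last completed pass, or 0; since then nothing but injections
  -- offsets the unit decrease per round.
  have key : ∃ s T, t = s + T ∧ ∑ j, R.potential t j + T ≤
      2 * (n * n) + b + ∑ t ∈ Ico s (s + T), ∑ j, inj t j := by
    induction t with
    | zero =>
      refine ⟨0, 0, rfl, ?_⟩
      have := hS 0
      simp [len, R.queue_zero] at this
      simp; omega
    | succ t ih =>
      by_cases hc : R.comp t = 1
      · refine ⟨t + 1, 0, rfl, ?_⟩
        have := hS (t + 1)
        have := R.sum_len_le_of_completes hb hc
        simp; omega
      · obtain ⟨s, T, rfl, h⟩ := ih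
        refine ⟨s, T + 1, rfl, ?_⟩
        have h0 : R.comp (s + T) = 0 := by
          rcases R.round_cases (s + T) with h | h | h <;> omega
        have := R.sum_potential_succ_le (s + T)
        rw [h0] at this
        simp only [← add_assoc s T 1]
        rw [Finset.sum_Ico_succ_top (by omega)]
        omega
  obtain ⟨s, T, -, h⟩ := key
  have := hb s T
  omega

/-- Station `i` holds the token in round `t` and its first packet is `p`. -/
def Serves (t : ℕ) (p : Packet n) : Prop := (R.queue t (R.holder t)).head? = some p

/-- While a packet waits, the passes that are completed are paid for by its progress. -/
theorem waiting_invariant {i : Fin n} {p : Packet n} {s : ℕ} (hp : p ∈ R.queue s i) (T : ℕ)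
    (hw : ∀ t ∈ Ico s (s + T), ¬ R.Serves t p) :
    ∃ l l', R.queue (s + T) i = l ++ p :: l' ∧
      ∑ t ∈ Ico s (s + T), R.comp t + min l.length (n - 1) +
        (if R.pos (s + T) i < R.tok (s + T) then 1 else 0) ≤ n := by
  induction T with
  | zero =>
    obtain ⟨l, l', h⟩ := List.append_of_mem hp
    refine ⟨l, l', h, ?_⟩
    have := i.pos
    simp only [add_zero, Ico_self, sum_empty]
    split_ifs <;> omega
  | succ T ih =>
    obtain ⟨l, l', hq, hle⟩ := ih fun t ht => hw t (by simp at ht ⊢; omega)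
    have hns := hw (s + T) (by simp)
    have hpl := R.pos_lt (s + T) i
    have hpe := R.pos_eq_iff (s + T) i
    simp only [← add_assoc s T 1]
    rw [R.queue_succ, Finset.sum_Ico_succ_top (by omega)]
    by_cases hi : i = R.holder (s + T)
    · have hlen : R.len (s + T) i = l.length + l'.length + 1 := by simp [len, hq]; omega
      cases l with
      | nil => exact absurd (by simp [Serves, ← hi, hq]) hns
      | cons a l =>
        refine ⟨l, l' ++ newPackets (s + T) i (inj (s + T) i), by simp [← hi, hq], ?_⟩
        have := hpe.2 hi
        -- If `i` is small, fewer than n - 1 packets precede `p`, so the truncated minimum really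
        -- drops by one; this pays for the new indicator or, if `i` is last, for the completed pass.
        rw [List.length_cons] at *
        rcases R.round_cases (s + T) with ⟨hb, hc, hk, hp⟩ | ⟨hb, hc, hm, hk, hp⟩ |
            ⟨hb, hc, hm, hk, hp⟩ <;>
        · rw [← hi] at hb
          rw [hk, hc]
          split_ifs at hle ⊢ <;> omega
    · refine ⟨l, l' ++ newPackets (s + T) i (inj (s + T) i), by simp [hi, hq], ?_⟩
      -- When a pass is completed, `i` lies before the token; its indicator falls from 1 to 0 and
      -- pays for the pass.
      have := mt hpe.1 hi
      rcases R.round_cases (s + T) with ⟨hb, hc, hk, hp⟩ | ⟨hb, hc, hm, hk, hp⟩ |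
          ⟨hb, hc, hm, hk, hp⟩ <;>
      · rw [hk, hc, hp i]
        split_ifs at hle ⊢ <;> omega

theorem waiting_time_le {b : ℕ} (hb : ∀ s T, ∑ t ∈ Ico s (s + T), ∑ j, inj t j ≤ T + b)
    {i : Fin n} {p : Packet n} {s : ℕ} (hp : p ∈ R.queue s i) (T : ℕ)
    (hw : ∀ t ∈ Ico s (s + T), ¬ R.Serves t p) :
    T ≤ 3 * (n * n) + 2 * b + ∑ t ∈ Ico s (s + T), ∑ j, inj t j := by
  obtain ⟨l, l', -, h⟩ := R.waiting_invariant hp T hw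
  have h1 := R.sum_potential_add_le s T
  have h2 := R.sum_potential_le hb s
  have h3 : n * ∑ t ∈ Ico s (s + T), R.comp t ≤ n * n := Nat.mul_le_mul_left _ (by omega)
  omega

end TokenTrace

/-! ### List positions and feedback with one transmitter -/

theorem idxOf_erase_of_nodup {α : Type*} [DecidableEq α] {l : List α} (hl : l.Nodup) {a x : α}
    (ha : a ∈ l) (hx : x ≠ a) :
    (l.erase a).idxOf x + (if l.idxOf x < l.idxOf a then 0 else 1) = l.idxOf x := by
  induction l with
  | nil => simp at ha
  | cons c l ih =>
    rw [List.nodup_cons] at hl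
    by_cases hc : c = a
    · subst hc
      simp [List.idxOf_cons_ne _ hx.symm]
    · have ha' : a ∈ l := by simpa [Ne.symm hc] using ha
      rw [List.erase_cons_tail (by simpa using hc), List.idxOf_cons_ne _ hc]
      by_cases hxc : c = x
      · simp [hxc]
      · rw [List.idxOf_cons_ne _ hxc, List.idxOf_cons_ne _ hxc]
        have := ih hl.2 ha'
        simp only [Nat.succ_eq_add_one, add_lt_add_iff_right] at *
        omega

theorem MBTFVar.exists_holder {n : ℕ} {v : MBTFVar n} (hn : v.order.length = n) (ht : v.token < n) :
    ∃ h, v.holder = some h :=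
  ⟨_, List.getElem?_eq_getElem (by omega)⟩

theorem channelFeedback_of_unique {n : ℕ} {Bits : Type} {tx : Fin n → Option (Message n Bits)} (h : Fin n)
    (htx : ∀ i, i ≠ h → tx i = none) : channelFeedback tx = tx h := by
  have key : (List.finRange n).filterMap tx = (tx h).toList := by
    have : ∀ l : List (Fin n), l.Nodup → l.filterMap tx = if h ∈ l then (tx h).toList else [] := by
      intro l hl
      induction l with
      | nil => simp
      | cons a l ih =>
        rw [List.nodup_cons] at hl
        rw [List.filterMap_cons, ih hl.2]
        by_cases ha : a = h
        · subst ha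
          rw [if_neg hl.1]
          cases tx a <;> simp
        · rw [htx a ha]
          simp [Ne.symm ha]
    rw [this _ (List.nodup_finRange n), if_pos (List.mem_finRange h)]
  unfold channelFeedback
  rw [key]
  cases tx h <;> rfl

/-! ### Move-Big-To-Front as a token process -/

section Execution

variable {n : ℕ} [NeZero n] (cr : Bool) (inj : Injection n)

/-- The common private variables of all stations at the beginning of a round. -/
def sharedVar (t : ℕ) : MBTFVar n := ((MBTF n cr).config inj t 0).vars

/-- The initial variables are equal, and the update uses only the old variables and the common
feedback. -/
theorem vars_eq_sharedVar (t : ℕ) (i : Fin n) :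
    ((MBTF n cr).config inj t i).vars = sharedVar cr inj t := by
  unfold sharedVar
  induction t generalizing i with
  | zero => rfl
  | succ t ih =>
    simp only [Algorithm.config, Algorithm.step, MBTF]
    simp only [MBTF] at ih
    rw [ih i]

/-- The message of a token holder whose queue is `q`. -/
def holderMessage (n : ℕ) (cr : Bool) (q : List (Packet n)) : Option (Message n Bool) :=
  if 0 < q.length then some ⟨q.head?, decide (n ≤ q.length)⟩
  else if cr then some ⟨none, false⟩ else none

theorem transmission_holder {t : ℕ} {h : Fin n} (hh : (sharedVar cr inj t).holder = some h) :
    (MBTF n cr).transmission h ((MBTF n cr).config inj t h) =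
      holderMessage n cr ((MBTF n cr).config inj t h).queue := by
  have := vars_eq_sharedVar cr inj t h
  unfold Algorithm.transmission holderMessage
  generalize (MBTF n cr).config inj t h = c at *
  obtain ⟨v, q⟩ := c
  simp only at this
  subst this
  cases q <;> cases cr <;> simp [MBTF, hh]

theorem transmission_of_ne {t : ℕ} {h i : Fin n} (hh : (sharedVar cr inj t).holder = some h)
    (hi : i ≠ h) : (MBTF n cr).transmission i ((MBTF n cr).config inj t i) = none := by
  have := vars_eq_sharedVar cr inj t i
  unfold Algorithm.transmission
  generalize (MBTF n cr).config inj t i = c at *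
  obtain ⟨v, q⟩ := c
  simp only at this
  subst this
  simp [MBTF, hh, Ne.symm hi]

theorem feedback_eq {t : ℕ} {h : Fin n} (hh : (sharedVar cr inj t).holder = some h) :
    (MBTF n cr).feedback ((MBTF n cr).config inj t) =
      holderMessage n cr ((MBTF n cr).config inj t h).queue := by
  unfold Algorithm.feedback
  rw [channelFeedback_of_unique h fun i hi => transmission_of_ne cr inj hh hi,
    transmission_holder cr inj hh]

theorem queue_succ {t : ℕ} {h : Fin n} (hh : (sharedVar cr inj t).holder = some h) (j : Fin n) :
    ((MBTF n cr).config inj (t + 1) j).queue =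
      (if j = h then ((MBTF n cr).config inj t j).queue.tail
        else ((MBTF n cr).config inj t j).queue) ++ newPackets t j (inj t j) := by
  simp only [Algorithm.config, Algorithm.step]
  rw [feedback_eq cr inj hh]
  congr 1
  by_cases hj : j = h
  · subst hj
    rw [transmission_holder cr inj hh, if_pos rfl]
    generalize ((MBTF n cr).config inj t j).queue = q
    cases q <;> cases cr <;> simp [holderMessage, queueAfterFeedback]
  · rw [transmission_of_ne cr inj hh hj, if_neg hj]
    rfl

theorem sharedVar_succ {t : ℕ} {h : Fin n} (hh : (sharedVar cr inj t).holder = some h) :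
    sharedVar cr inj (t + 1) =
      if n ≤ ((MBTF n cr).config inj t h).queue.length then (sharedVar cr inj t).moveToFront
      else (sharedVar cr inj t).passToken := by
  have h1 : ∀ fb : Option (Message n Bool),
      (MBTF n cr).feedback ((MBTF n cr).config inj t) = fb → sharedVar cr inj (t + 1) =
        match fb with
        | some m => if m.bits then (sharedVar cr inj t).moveToFront
          else (sharedVar cr inj t).passToken
        | none => (sharedVar cr inj t).passToken := by
    rintro _ rfl
    rfl
  rw [h1 _ (feedback_eq cr inj hh)]
  -- An empty queue is not big because 0 < n; silence and a false control bit both pass the token.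
  have := NeZero.pos n
  generalize ((MBTF n cr).config inj t h).queue = q
  rcases q with _ | ⟨a, q⟩
  · cases cr <;> simp [holderMessage, NeZero.ne n]
  · simp [holderMessage]

theorem sharedVar_wf (t : ℕ) : (sharedVar cr inj t).order.Perm (List.finRange n) ∧
    (sharedVar cr inj t).token < n := by
  induction t with
  | zero => exact ⟨List.Perm.refl _, NeZero.pos n⟩
  | succ t ih =>
    obtain ⟨h, hh⟩ := MBTFVar.exists_holder (by simpa using ih.1.length_eq) ih.2
    rw [sharedVar_succ cr inj hh]
    split_ifs
    · simp only [MBTFVar.moveToFront, hh]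
      refine ⟨(List.perm_cons_erase ?_).symm.trans ih.1, NeZero.pos n⟩
      exact List.mem_of_getElem? hh
    · exact ⟨ih.1, Nat.mod_lt _ (NeZero.pos n)⟩

theorem exists_holder (t : ℕ) : ∃ h, (sharedVar cr inj t).holder = some h :=
  MBTFVar.exists_holder (by simpa using (sharedVar_wf cr inj t).1.length_eq) (sharedVar_wf cr inj t).2

/-- The station that holds the token. -/
noncomputable def tokenHolder (t : ℕ) : Fin n := (exists_holder cr inj t).choose

theorem holder_eq (t : ℕ) : (sharedVar cr inj t).holder = some (tokenHolder cr inj t) :=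
  (exists_holder cr inj t).choose_spec

theorem idxOf_eq_token_iff (t : ℕ) (j : Fin n) :
    (sharedVar cr inj t).order.idxOf j = (sharedVar cr inj t).token ↔ j = tokenHolder cr inj t := by
  have hw := sharedVar_wf cr inj t
  have hh := holder_eq cr inj t
  have hnd : (sharedVar cr inj t).order.Nodup := hw.1.nodup_iff.2 (List.nodup_finRange n)
  unfold MBTFVar.holder at hh
  obtain ⟨hlt, hh⟩ := List.getElem?_eq_some_iff.1 hh
  rw [← hh]
  constructor
  · intro h
    have hm : j ∈ (sharedVar cr inj t).order := hw.1.mem_iff.2 (List.mem_finRange j)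
    have := List.getElem_idxOf (List.idxOf_lt_length_of_mem hm)
    simp only [h] at this
    exact this.symm
  · rintro rfl
    exact hnd.idxOf_getElem _ hlt

/-- The execution of Move-Big-To-Front as a centralized token process. -/
noncomputable def tokenTrace : TokenTrace n inj where
  pos t j := (sharedVar cr inj t).order.idxOf j
  tok t := (sharedVar cr inj t).token
  holder t := tokenHolder cr inj t
  queue t j := ((MBTF n cr).config inj t j).queue
  pos_lt t j := by
    have hw := (sharedVar_wf cr inj t).1
    have := List.idxOf_lt_length_of_mem (hw.mem_iff.2 (List.mem_finRange j))
    simpa [hw.length_eq] using this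
  pos_eq_iff := idxOf_eq_token_iff cr inj
  tok_zero := rfl
  queue_zero _ := rfl
  queue_succ t j := queue_succ cr inj (holder_eq cr inj t) j
  tok_succ_of_big t h := by
    rw [sharedVar_succ cr inj (holder_eq cr inj t), if_pos h]
    simp [MBTFVar.moveToFront, holder_eq]
  pos_succ_of_big t j h := by
    rw [sharedVar_succ cr inj (holder_eq cr inj t), if_pos h]
    simp only [MBTFVar.moveToFront, holder_eq]
    have hw := (sharedVar_wf cr inj t).1
    by_cases hj : j = tokenHolder cr inj t
    · simp [hj]
    · rw [if_neg hj, List.idxOf_cons_ne _ (Ne.symm hj)]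
      have := idxOf_erase_of_nodup (hw.nodup_iff.2 (List.nodup_finRange n))
        (hw.mem_iff.2 (List.mem_finRange (tokenHolder cr inj t))) hj
      rw [(idxOf_eq_token_iff cr inj t (tokenHolder cr inj t)).2 rfl] at this
      split_ifs at this ⊢ <;> omega
  tok_succ_of_small t h := by
    rw [sharedVar_succ cr inj (holder_eq cr inj t), if_neg (by omega)]
    rfl
  pos_succ_of_small t j h := by
    rw [sharedVar_succ cr inj (holder_eq cr inj t), if_neg (by omega)]
    rfl

theorem heardIn_of_serves {t : ℕ} {p : Packet n} (h : (tokenTrace cr inj).Serves t p) :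
    (MBTF n cr).HeardIn inj t p := by
  change ((MBTF n cr).config inj t (tokenHolder cr inj t)).queue.head? = some p at h
  obtain ⟨l, hl⟩ := List.head?_eq_some_iff.1 h
  have hm : holderMessage n cr ((MBTF n cr).config inj t (tokenHolder cr inj t)).queue =
      some ⟨some p, decide (n ≤ (p :: l).length)⟩ := by
    rw [hl, holderMessage, if_pos (by simp), List.head?_cons]
  exact ⟨_, (feedback_eq cr inj (holder_eq cr inj t)).trans hm, rfl⟩

end Execution

/-! ### The latency bound -/

theorem MBTF_packetLatencyAtMost {n : ℕ} (hn : 1 ≤ n) {ρ : ℝ} (hρ0 : 0 ≤ ρ) (hρ1 : ρ < 1) (b : ℕ)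
    (cr : Bool) : (MBTF n cr).PacketLatencyAtMost ρ b (5 * ((n : ℝ) * (n + b) / (1 - ρ))) := by
  have : NeZero n := ⟨by omega⟩
  intro inj hinj t i k hk
  have hb : ∀ s T, ∑ t ∈ Ico s (s + T), ∑ j, inj t j ≤ T + b := by
    intro s T
    rcases Nat.eq_zero_or_pos T with rfl | hT
    · simp
    · have := hinj s T hT
      have h2 : ρ * T ≤ T := mul_le_of_le_one_left (Nat.cast_nonneg _) hρ1.le
      exact_mod_cast this.trans (add_le_add_left h2 _)
  have hpos : 0 < 1 - ρ := by linarith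
  set B : ℝ := (3 * (n * n) + 3 * b) / (1 - ρ) with hB
  have hB0 : 0 ≤ B := by positivity
  have hmem : (⟨t, i, k⟩ : Packet n) ∈ (tokenTrace cr inj).queue (t + 1) i := by
    rw [(tokenTrace cr inj).queue_succ]
    simp [newPackets, hk]
  obtain ⟨t', ht', hs⟩ : ∃ t' ∈ Ico (t + 1) (t + 1 + (⌊B⌋₊ + 1)),
      (tokenTrace cr inj).Serves t' ⟨t, i, k⟩ := by
    by_contra! hcon
    have h1 := (tokenTrace cr inj).waiting_time_le hb hmem _ hcon
    have h2 := hinj (t + 1) (⌊B⌋₊ + 1) (Nat.succ_pos _)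
    have h3 : B < ((⌊B⌋₊ + 1 : ℕ) : ℝ) := by exact_mod_cast Nat.lt_floor_add_one B
    rw [hB, div_lt_iff₀ hpos] at h3
    have h1' := (Nat.cast_le (α := ℝ)).2 h1
    rw [Nat.cast_add] at h1'
    push_cast at h1' h2 h3
    linarith
  rw [Finset.mem_Ico] at ht'
  refine ⟨t', by omega, heardIn_of_serves cr inj hs, ?_⟩
  have h1 : (t' : ℝ) ≤ t + 1 + ⌊B⌋₊ := by exact_mod_cast (by omega : t' ≤ t + 1 + ⌊B⌋₊)
  have h2 := Nat.floor_le hB0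
  have hn' : (1 : ℝ) ≤ n := by exact_mod_cast hn
  have hb' : (0 : ℝ) ≤ b := Nat.cast_nonneg b
  -- The 2 comes from waiting that starts at `t + 1` and from counting both end rounds; it is
  -- absorbed by 2n², giving the constant 5 = 3 + 2.
  have h3 : B + 2 ≤ 5 * ((n : ℝ) * (n + b) / (1 - ρ)) := by
    rw [hB, ← mul_div_assoc, div_add' _ _ _ hpos.ne', div_le_div_iff_of_pos_right hpos]
    nlinarith [mul_nonneg (sub_nonneg.2 hn') hb', mul_nonneg (sub_nonneg.2 hn') (sub_nonneg.2 hn')]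
  linarith

end MAC

theorem mainTheorem9 :
    ∃ C : ℝ, 0 < C ∧
      ∀ (n : ℕ) (_hn : 1 ≤ n) (ρ : ℝ) (_hρ0 : 0 ≤ ρ) (_hρ1 : ρ < 1) (b : ℕ) (controlRounds : Bool),
        (MAC.MBTF n controlRounds).PacketLatencyAtMost ρ b
          (C * ((n : ℝ) * ((n : ℝ) + (b : ℝ)) / (1 - ρ))) :=
  ⟨5, by norm_num, fun _ hn _ hρ0 hρ1 b cr => MAC.MBTF_packetLatencyAtMost hn hρ0 hρ1 b cr⟩
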